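/- Let $\Gamma$ be a set of continuous, piecewise monotone (with finitely many pieces, not necessarily strictly monotone) maps $g:[0,1]\to[0,1]$, equipped with the topology of uniform convergence, and let $\mu$ be a Borel probability measure on $\Gamma$ with $\operatorname{supp}\mu=\Gamma$. Put $\Gamma_0=\{g\in\Gamma: g(0)=0\}$ and $\Gamma_1=\{g\in\Gamma: g(1)=1\}$. Assume that: (i) for every $x\in(0,1]$ there is $g\in\Gamma_0$ with $g(x)\in(0,x)$, and for every $x\in[0,1)$ there is $h\in\Gamma_1$ with $h(x)\in(x,1)$; (ii) $(\Gamma,\mu)$ is $\mu$-injective: $\int_\Gamma n(g,x)\,d\mu(g)\le 1$ for every $x\in[0,1]$, where $n(g,x)\in\{0,1,2,\dots,\infty\}$ is the number of elements of $g^{-1}(\{x\})$; (iii) $(\Gamma,\mu)$ is below the diagonal on the left, i.e. $\mu(\{g\in\Gamma:\exists\,\varepsilon>0\ \forall x\in(0,\varepsilon)\ g(x)<x\})>0$, or above the diagonal on the right, i.e. $\mu(\{g\in\Gamma:\exists\,\varepsilon>0\ \forall x\in(1-\varepsilon,1)\ g(x)>x\})>0$. Then $(\Gamma,\mu)$ is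 uniquely ergodic: there exists exactly one Borel probability measure $\nu$ on $[0,1]$ that is $\mu$-invariant, i.e. satisfies $\nu(A)=\int_\Gamma\nu(g^{-1}(A))\,d\mu(g)$ for every Borel set $A\subseteq[0,1]$. -/

import Mathlib

open MeasureTheory Set

namespace RandomMaps

/-- A continuous self-map `g` of `[0,1]` is piecewise monotone (with finitely many pieces): there are
`0 = t 0 ≤ t 1 ≤ ⋯ ≤ t n = 1` such that `g` is non-decreasing or non-increasing on each
`[t i, t (i+1)]`, `i < n`. -/
def PiecewiseMonotone (g : C(unitInterval, unitInterval)) : Prop :=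
  ∃ (n : ℕ) (t : ℕ → unitInterval), Monotone t ∧ t 0 = 0 ∧ t n = 1 ∧
    ∀ i < n, MonotoneOn g (Icc (t i) (t (i + 1))) ∨ AntitoneOn g (Icc (t i) (t (i + 1)))

/-- The maps of `Γ` that fix the left end point `0`. -/
def fixZero (Γ : Set C(unitInterval, unitInterval)) : Set C(unitInterval, unitInterval) :=
  {g | g ∈ Γ ∧ g 0 = 0}

/-- The maps of `Γ` that fix the right end point `1`. -/
def fixOne (Γ : Set C(unitInterval, unitInterval)) : Set C(unitInterval, unitInterval) :=
  {g | g ∈ Γ ∧ g 1 = 1}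

/-- Condition `(𝔄)`: every `x ∈ (0,1]` is moved into `(0,x)` by some `g ∈ Γ` fixing `0`, and every
`x ∈ [0,1)` is moved into `(x,1)` by some `h ∈ Γ` fixing `1`. -/
def ConditionA (Γ : Set C(unitInterval, unitInterval)) : Prop :=
  (∀ x ∈ Ioc (0 : unitInterval) 1, ∃ g ∈ fixZero Γ, g x ∈ Ioo 0 x) ∧
    (∀ x ∈ Ico (0 : unitInterval) 1, ∃ h ∈ fixOne Γ, h x ∈ Ioo x 1)

variable {Γ : Set C(unitInterval, unitInterval)} [MeasurableSpace Γ]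

/-- With positive probability a random map lies strictly below the diagonal on some interval
`(0,ε)`, where `ε` may depend on the map. -/
def BelowDiagonalLeft (μ : Measure Γ) : Prop :=
  0 < μ {g : Γ | ∃ ε : ℝ, 0 < ε ∧ ∀ x : unitInterval, (x : ℝ) ∈ Ioo 0 ε → g.1 x < x}

/-- With positive probability a random map lies strictly above the diagonal on some interval
`(1-ε,1)`, where `ε` may depend on the map. -/
def AboveDiagonalRight (μ : Measure Γ) : Prop :=
  0 < μ {g : Γ | ∃ ε : ℝ, 0 < ε ∧ ∀ x : unitInterval, (x : ℝ) ∈ Ioo (1 - ε) 1 → x < g.1 x}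

/-- `μ`-injectivity: for every `x ∈ [0,1]` the `μ`-average of the number (possibly `∞`) of
preimages of `x` is at most `1`. -/
def MuInjective (μ : Measure Γ) : Prop :=
  ∀ x : unitInterval, ∫⁻ g : Γ, ((g.1 ⁻¹' {x}).encard : ENNReal) ∂μ ≤ 1

/-- A measure `ν` on `[0,1]` is `μ`-invariant (`μ`-stationary):
`ν(A) = ∫ ν(g⁻¹(A)) dμ(g)` for every Borel set `A`. -/
def MuInvariant (μ : Measure Γ) (ν : Measure unitInterval) : Prop :=
  ∀ A : Set unitInterval, MeasurableSet A → ν A = ∫⁻ g : Γ, ν (g.1 ⁻¹' A) ∂μ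

/-- Unique ergodicity: there is exactly one `μ`-invariant Borel probability measure on `[0,1]`. -/
def UniquelyErgodic (μ : Measure Γ) : Prop :=
  ∃! ν : Measure unitInterval, IsProbabilityMeasure ν ∧ MuInvariant μ ν

end RandomMaps

namespace RandomMaps

open Filter Topology
open scoped BoundedContinuousFunction

/-! ### Existence of an invariant measure (Krylov–Bogoliubov) -/

section Transfer

variable {Γ : Set C(unitInterval, unitInterval)}

/-! Existence is the Krylov–Bogoliubov argument. Uniqueness rests on a maximum principle
(`ae_forall_mem_apply_ne`): since fibres have at most one point on average, a quantity whose average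
is bounded by fibre sums can attain its maximum at `x` only if almost every fibre over `x` consists
of maximum points.

Applied to the masses of points, it makes the set of heaviest atoms finite and forward invariant,
which `ConditionA` forbids. So invariant measures have no atoms, and the difference `D` of two
distribution functions is continuous.

Let `M = max |D|` and suppose `M > 0`. Closed sets with finite frontier inside `{|D| = M}` have mass
difference in `M ℤ`, so one of them maximizes it. Invariance and the maximum principle show that
almost every preimage of a maximizer is a maximizer. Maximizers are stable under intersection, so by
compactness the intersection of all of them is nonempty once each of them is. It is closed and, by
full support, forward invariant, hence contains `0`. But if `D = -M` at the least extremal point `a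
> 0`, each maximizer can be cut down to `[a, 1]`: a contradiction. If `D a = M`, exchange the two
measures. -/

theorem continuous_eval : Continuous fun p : Γ × unitInterval => p.1.1 p.2 := by fun_prop

variable [MeasurableSpace Γ] [BorelSpace Γ]

theorem measurable_eval : Measurable fun p : Γ × unitInterval => p.1.1 p.2 :=
  continuous_eval.measurable

/-- The law of `g x` when `g` has law `μ` and, independently, `x` has law `ν`. -/
noncomputable def transfer (μ : Measure Γ) (ν : Measure unitInterval) : Measure unitInterval :=
  (μ.prod ν).map fun p => p.1.1 p.2

theorem transfer_apply (μ : Measure Γ) (ν : Measure unitInterval) [SFinite ν]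
    {A : Set unitInterval} (hA : MeasurableSet A) :
    transfer μ ν A = ∫⁻ g : Γ, ν (g.1 ⁻¹' A) ∂μ := by
  rw [transfer, Measure.map_apply measurable_eval hA, Measure.prod_apply (measurable_eval hA)]
  rfl

theorem measurable_measure_preimage (ν : Measure unitInterval) [SFinite ν]
    {A : Set unitInterval} (hA : MeasurableSet A) : Measurable fun g : Γ => ν (g.1 ⁻¹' A) :=
  measurable_measure_prodMk_left (measurable_eval hA)

theorem muInvariant_of_transfer_eq {μ : Measure Γ} {ν : Measure unitInterval} [SFinite ν]
    (h : transfer μ ν = ν) : MuInvariant μ ν := fun A hA => by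
  rw [← transfer_apply μ ν hA, h]

instance (μ : Measure Γ) (ν : Measure unitInterval) [IsProbabilityMeasure μ]
    [IsProbabilityMeasure ν] : IsProbabilityMeasure (transfer μ ν) :=
  Measure.isProbabilityMeasure_map measurable_eval.aemeasurable

/-- The Markov operator on continuous functions. -/
noncomputable def markovOperator (μ : Measure Γ) [IsProbabilityMeasure μ]
    (φ : unitInterval →ᵇ ℝ) : unitInterval →ᵇ ℝ :=
  BoundedContinuousFunction.mkOfCompact
    ⟨fun x => ∫ g : Γ, φ (g.1 x) ∂μ, by
      refine continuous_of_dominated (bound := fun _ => ‖φ‖) (fun x => ?_) (fun x => ?_)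
        (integrable_const _) ?_
      · exact (by fun_prop : Continuous fun g : Γ => φ (g.1 x)).aestronglyMeasurable
      · exact .of_forall fun g => φ.norm_coe_le_norm _
      · exact .of_forall fun g => by fun_prop⟩

theorem integral_transfer (μ : Measure Γ) [IsProbabilityMeasure μ] (ν : Measure unitInterval)
    [IsProbabilityMeasure ν] (φ : unitInterval →ᵇ ℝ) :
    ∫ x, φ x ∂(transfer μ ν) = ∫ x, markovOperator μ φ x ∂ν := by
  have hc : Continuous fun p : Γ × unitInterval => φ (p.1.1 p.2) := φ.continuous.comp continuous_eval
  rw [transfer, integral_map measurable_eval.aemeasurable φ.continuous.aestronglyMeasurable,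
    integral_prod_symm]
  · rfl
  · exact (integrable_const ‖φ‖).mono' hc.aestronglyMeasurable
      (.of_forall fun p => φ.norm_coe_le_norm _)

/-- Cesàro averages of the laws of the orbit of `0`. -/
noncomputable def cesaro (μ : Measure Γ) (n : ℕ) : Measure unitInterval :=
  ((n : ENNReal) + 1)⁻¹ • ∑ k ∈ Finset.range (n + 1), (transfer μ)^[k] (Measure.dirac 0)

theorem isProbabilityMeasure_iterate_transfer (μ : Measure Γ) [IsProbabilityMeasure μ] (k : ℕ) :
    IsProbabilityMeasure ((transfer μ)^[k] (Measure.dirac 0)) := by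
  induction k with
  | zero => exact inferInstanceAs (IsProbabilityMeasure (Measure.dirac 0))
  | succ k ih => rw [Function.iterate_succ_apply']; infer_instance

theorem isProbabilityMeasure_cesaro (μ : Measure Γ) [IsProbabilityMeasure μ] (n : ℕ) :
    IsProbabilityMeasure (cesaro μ n) := by
  have h := isProbabilityMeasure_iterate_transfer μ
  constructor
  simp only [cesaro, Measure.smul_apply, Measure.coe_finsetSum, Finset.sum_apply, measure_univ,
    Finset.sum_const, Finset.card_range, smul_eq_mul, nsmul_eq_mul, mul_one]
  push_cast
  exact ENNReal.inv_mul_cancel (by simp) (by finiteness)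

theorem integral_cesaro (μ : Measure Γ) [IsProbabilityMeasure μ] (n : ℕ)
    (φ : unitInterval →ᵇ ℝ) :
    ∫ x, φ x ∂(cesaro μ n) = ((n : ℝ) + 1)⁻¹ *
      ∑ k ∈ Finset.range (n + 1), ∫ x, φ x ∂((transfer μ)^[k] (Measure.dirac 0)) := by
  have h := isProbabilityMeasure_iterate_transfer μ
  rw [cesaro, integral_smul_measure, integral_finsetSum_measure]
  · rw [ENNReal.toReal_inv, ENNReal.toReal_add (by simp) (by simp)]
    simp
  · exact fun k _ => φ.integrable _

/-- The operator shifts the orbit of laws by one step, so the sum telescopes to its two end terms.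
-/
theorem abs_integral_markovOperator_sub_le (μ : Measure Γ) [IsProbabilityMeasure μ] (n : ℕ)
    (φ : unitInterval →ᵇ ℝ) :
    |∫ x, markovOperator μ φ x ∂(cesaro μ n) - ∫ x, φ x ∂(cesaro μ n)|
      ≤ ((n : ℝ) + 1)⁻¹ * (2 * ‖φ‖) := by
  have h := isProbabilityMeasure_iterate_transfer μ
  rw [integral_cesaro, integral_cesaro, ← mul_sub, ← Finset.sum_sub_distrib, abs_mul,
    abs_of_nonneg (by positivity)]
  gcongr
  have key : ∀ k, ∫ x, markovOperator μ φ x ∂((transfer μ)^[k] (Measure.dirac 0)) =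
      ∫ x, φ x ∂((transfer μ)^[k + 1] (Measure.dirac 0)) := fun k => by
    rw [Function.iterate_succ_apply', integral_transfer]
  simp_rw [key]
  rw [Finset.sum_range_sub (fun k => ∫ x, φ x ∂((transfer μ)^[k] (Measure.dirac 0)))]
  have hb : ∀ k, |∫ x, φ x ∂((transfer μ)^[k] (Measure.dirac 0))| ≤ ‖φ‖ := fun k => by
    simpa using φ.norm_integral_le_norm ((transfer μ)^[k] (Measure.dirac 0))
  calc _ ≤ _ := abs_sub _ _
    _ ≤ ‖φ‖ + ‖φ‖ := add_le_add (hb _) (hb _)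
    _ = _ := by ring

theorem exists_invariant (μ : Measure Γ) [IsProbabilityMeasure μ] :
    ∃ ν : Measure unitInterval, IsProbabilityMeasure ν ∧ MuInvariant μ ν := by
  let m : ℕ → ProbabilityMeasure unitInterval := fun n => ⟨cesaro μ n, isProbabilityMeasure_cesaro μ n⟩
  let U : Ultrafilter ℕ := hyperfilter ℕ
  obtain ⟨ν, -, hν⟩ := isCompact_univ.ultrafilter_le_nhds (U.map m) (by simp)
  have hlim : Tendsto m U (𝓝 ν) := hν
  rw [ProbabilityMeasure.tendsto_iff_forall_integral_tendsto] at hlim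
  have hU : (U : Filter ℕ) ≤ atTop := by
    rw [← Nat.cofinite_eq_atTop]; exact hyperfilter_le_cofinite
  refine ⟨ν, inferInstance, muInvariant_of_transfer_eq ?_⟩
  refine ext_of_forall_integral_eq_of_IsFiniteMeasure fun φ => ?_
  rw [integral_transfer]
  have h0 : Tendsto (fun n : ℕ => ((n : ℝ) + 1)⁻¹ * (2 * ‖φ‖)) U (𝓝 0) := by
    have := (tendsto_one_div_add_atTop_nhds_zero_nat (𝕜 := ℝ)).mul_const (2 * ‖φ‖)
    simp only [one_div, zero_mul] at this
    exact this.mono_left hU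
  have h1 := squeeze_zero_norm (f := fun n => ∫ x, markovOperator μ φ x ∂(cesaro μ n) - ∫ x, φ x ∂(cesaro μ n))
    (fun n => abs_integral_markovOperator_sub_le μ n φ) h0
  exact sub_eq_zero.1 (tendsto_nhds_unique ((hlim (markovOperator μ φ)).sub (hlim φ)) h1)

end Transfer

/-! ### Fibres and the maximum principle -/

section MaximumPrinciple

/-- On a monotone piece, two points of a fibre force the whole interval between them into it. If the
fibre contains no interval, each piece contributes at most one point. -/
theorem PiecewiseMonotone.exists_eq_on_Icc {g : C(unitInterval, unitInterval)}
    (hg : PiecewiseMonotone g) {x : unitInterval} (hx : (g ⁻¹' {x}).Infinite) :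
    ∃ p q, p < q ∧ ∀ y ∈ Icc p q, g y = x := by
  by_contra! hne
  obtain ⟨n, t, -, h0, h1, hmono⟩ := hg
  have key : ∀ k ≤ n, (g ⁻¹' {x} ∩ Iic (t k)).Finite := by
    intro k
    induction k with
    | zero =>
      intro _
      refine (finite_singleton (0 : unitInterval)).subset fun y hy => ?_
      have := hy.2
      rw [h0] at this
      exact le_antisymm this y.2.1
    | succ k ih =>
      intro hk
      have hsub : (g ⁻¹' {x} ∩ Icc (t k) (t (k + 1))).Subsingleton := by
        have hlt : ∀ p ∈ g ⁻¹' {x} ∩ Icc (t k) (t (k + 1)),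
            ∀ q ∈ g ⁻¹' {x} ∩ Icc (t k) (t (k + 1)), ¬ p < q := by
          intro p hp q hq hpq
          obtain ⟨y, hy, hyx⟩ := hne p q hpq
          have hy' : y ∈ Icc (t k) (t (k + 1)) := ⟨hp.2.1.trans hy.1, hy.2.trans hq.2.2⟩
          have hpx : g p = x := hp.1
          have hqx : g q = x := hq.1
          rcases hmono k (by omega) with h | h
          · exact hyx (le_antisymm (hqx ▸ h hy' hq.2 hy.2) (hpx ▸ h hp.2 hy' hy.1))
          · exact hyx (le_antisymm (hpx ▸ h hp.2 hy' hy.1) (hqx ▸ h hy' hq.2 hy.2))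
        intro p hp q hq
        exact le_antisymm (not_lt.1 (hlt q hq p hp)) (not_lt.1 (hlt p hp q hq))
      refine ((ih (by omega)).union hsub.finite).subset fun y hy => ?_
      rcases le_total y (t k) with h | h
      · exact Or.inl ⟨hy.1, h⟩
      · exact Or.inr ⟨hy.1, h, hy.2⟩
  refine hx ((key n le_rfl).subset fun y hy => ⟨hy, ?_⟩)
  rw [h1]
  exact y.2.2

variable {Γ : Set C(unitInterval, unitInterval)}

theorem continuous_eval_left (x : unitInterval) : Continuous fun g : Γ => g.1 x := by fun_prop

theorem isClosed_exists_mem_eq {K : Set unitInterval} (hK : IsClosed K) (x : unitInterval) :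
    IsClosed {g : Γ | ∃ y ∈ K, g.1 y = x} := by
  have h := (ContinuousMap.isOpen_setOfPred_mapsTo (X := unitInterval) (Y := unitInterval)
    hK.isCompact (isOpen_compl_singleton (x := x))).preimage
    (continuous_subtype_val : Continuous fun g : Γ => g.1)
  rw [← isOpen_compl_iff]
  convert h using 1
  ext g
  simp [MapsTo]

variable [MeasurableSpace Γ] {μ : Measure Γ}

/-- A closed condition that holds almost surely holds on the support; this is how almost sure
statements become statements about every map. -/
theorem forall_apply_mem_of_ae (hsupp : μ.support = univ) {A : Set unitInterval}
    (hA : IsClosed A) {x : unitInterval} (h : ∀ᵐ g : Γ ∂μ, g.1 x ∈ A) (g : Γ) : g.1 x ∈ A := by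
  have := Measure.support_subset_of_isClosed (hA.preimage (continuous_eval_left (Γ := Γ) x)) h
  rw [hsupp] at this
  exact this (mem_univ g)

variable [BorelSpace Γ]

/-- An infinite fibre contains an interval, hence a set of a countable basis. For each basic set the
event is null, since the fibre count is infinite there but has finite mean. -/
theorem ae_finite_preimage_singleton (hΓ : ∀ g ∈ Γ, PiecewiseMonotone g) (hinj : MuInjective μ)
    (x : unitInterval) : ∀ᵐ g : Γ ∂μ, (g.1 ⁻¹' {x}).Finite := by
  have hzero : ∀ U ∈ TopologicalSpace.countableBasis unitInterval,
      ∀ᵐ g : Γ ∂μ, ¬ ∀ y ∈ U, g.1 y = x := by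
    intro U hU
    have hmeas : MeasurableSet {g : Γ | ∀ y ∈ U, g.1 y = x} := by
      simp only [ofPred_forall]
      exact (isClosed_biInter fun y _ =>
        isClosed_eq (continuous_eval_left y) continuous_const).measurableSet
    obtain ⟨y, hy⟩ := TopologicalSpace.nonempty_of_mem_countableBasis hU
    have hinf : U.Infinite := infinite_of_mem_nhds y
      ((TopologicalSpace.isOpen_of_mem_countableBasis hU).mem_nhds hy)
    have hle : ∫⁻ g : Γ, {g : Γ | ∀ y ∈ U, g.1 y = x}.indicator (fun _ => ⊤) g ∂μ ≤ 1 := by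
      refine (lintegral_mono fun g => ?_).trans (hinj x)
      refine indicator_apply_le' (M := ENNReal) (fun hg => by
      have hfib : (g.1 ⁻¹' {x}).Infinite := hinf.mono fun y hy => hg y hy
      rw [hfib.encard_eq]
      simp) fun _ => bot_le
    rw [lintegral_indicator_const hmeas] at hle
    rw [ae_iff]
    simp only [not_not]
    by_contra h0
    rw [ENNReal.top_mul h0] at hle
    simp at hle
  filter_upwards [(ae_ball_iff (TopologicalSpace.countable_countableBasis unitInterval)).2 hzero]
    with g hg
  by_contra hinf
  obtain ⟨p, q, hpq, h⟩ := (hΓ g.1 g.2).exists_eq_on_Icc hinf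
  obtain ⟨z, hz⟩ := exists_between hpq
  obtain ⟨U, hU, -, hsub⟩ := (TopologicalSpace.isBasis_countableBasis unitInterval).exists_subset_of_mem_open
    (show z ∈ Ioo p q from hz) isOpen_Ioo
  exact hg U hU fun y hy => h y (Ioo_subset_Icc_self (hsub hy))

/-- Maximum principle: if `u g` is bounded by the sum of `w ≤ M` over the fibre of `g` above `x`
and has mean at least `M`, then almost every fibre avoids the sets on which `w` is bounded away
from `M`. -/
theorem ae_forall_mem_apply_ne (hinj : MuInjective μ) {x : unitInterval} {M δ : ENNReal}
    (hM0 : M ≠ 0) (hM : M ≠ ⊤) (hδ : δ ≠ 0) {K : Set unitInterval} (hK : IsClosed K)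
    {w : unitInterval → ENNReal} (hw : ∀ y, w y ≤ M) (hwK : ∀ y ∈ K, w y + δ ≤ M)
    {u : Γ → ENNReal}
    (hu : ∀ (g : Γ) (T : Finset unitInterval), (T : Set unitInterval) = g.1 ⁻¹' {x} →
      u g ≤ ∑ y ∈ T, w y)
    (hint : M ≤ ∫⁻ g, u g ∂μ) : ∀ᵐ g : Γ ∂μ, ∀ y ∈ K, g.1 y ≠ x := by
  classical
  set B : Set Γ := {g : Γ | ∃ y ∈ K, g.1 y = x} with hB
  have hBm : MeasurableSet B := (isClosed_exists_mem_eq hK x).measurableSet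
  -- A fibre that meets `K` loses at least `δ` against the bound `M` per point; over an infinite
  -- fibre the right side is `⊤`.
  have hpt : ∀ g : Γ, u g + B.indicator (fun _ => δ) g ≤ M * ((g.1 ⁻¹' {x}).encard : ENNReal) := by
    intro g
    by_cases hfin : (g.1 ⁻¹' {x}).Finite
    · obtain ⟨T, hT⟩ := hfin.exists_finset_coe
      rw [← hT, encard_coe_eq_coe_finsetCard]
      have hsum : u g ≤ ∑ y ∈ T, w y := hu g T hT
      have hcard : ∑ _y ∈ T, M = M * ((T.card : ℕ∞) : ENNReal) := by
        simp [mul_comm]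
      rw [← hcard]
      by_cases hg : g ∈ B
      · obtain ⟨y, hyK, hy⟩ := hg
        have hyT : y ∈ T := by
          rw [← Finset.mem_coe, hT]; exact hy
        rw [indicator_of_mem (show g ∈ B from ⟨y, hyK, hy⟩)]
        refine (add_le_add_left hsum δ).trans ?_
        rw [← Finset.add_sum_erase T w hyT, ← Finset.add_sum_erase T (fun _ => M) hyT, add_right_comm]
        exact add_le_add (hwK y hyK) (Finset.sum_le_sum fun z _ => hw z)
      · rw [indicator_of_notMem hg, add_zero]
        exact hsum.trans (Finset.sum_le_sum fun z _ => hw z)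
    · rw [Infinite.encard_eq hfin]
      simp [ENNReal.mul_top hM0]
  have hle : M + δ * μ B ≤ M := by
    calc M + δ * μ B ≤ ∫⁻ g, u g ∂μ + δ * μ B := by gcongr
      _ = ∫⁻ g, (u g + B.indicator (fun _ => δ) g) ∂μ := by
        rw [lintegral_add_right _ (measurable_const.indicator hBm), lintegral_indicator_const hBm]
      _ ≤ ∫⁻ g, M * ((g.1 ⁻¹' {x}).encard : ENNReal) ∂μ := lintegral_mono hpt
      _ = M * ∫⁻ g, ((g.1 ⁻¹' {x}).encard : ENNReal) ∂μ := lintegral_const_mul' _ _ hM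
      _ ≤ M * 1 := by gcongr; exact hinj x
      _ = M := mul_one M
  have h0 : δ * μ B = 0 := by
    by_contra h
    exact absurd hle (not_le.2 (ENNReal.lt_add_right hM h))
  have hB0 : μ B = 0 := (mul_eq_zero.1 h0).resolve_left hδ
  rw [ae_iff]
  convert hB0 using 2
  ext g
  simp only [hB, mem_ofPred_eq, not_forall, not_not, exists_prop]

end MaximumPrinciple

/-! ### Invariant measures have no atoms -/

section Atoms

/-- The least point of `C`, if positive, would be moved further down. -/
theorem ConditionA.zero_mem {Γ : Set C(unitInterval, unitInterval)} (hA : ConditionA Γ)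
    {C : Set unitInterval} (hC : IsClosed C) (hne : C.Nonempty)
    (hinv : ∀ g ∈ Γ, ∀ x ∈ C, g x ∈ C) : (0 : unitInterval) ∈ C := by
  obtain ⟨c, hc, hmin⟩ := hC.isCompact.exists_isLeast hne
  rcases eq_or_ne c 0 with rfl | h0
  · exact hc
  · obtain ⟨g, hg, hgc⟩ := hA.1 c ⟨unitInterval.pos_iff_ne_zero.2 h0, c.2.2⟩
    exact absurd (hmin (hinv g hg.1 c hc)) (not_le.2 hgc.2)

/-- As `0 ∈ C`, a finite `C` would have a largest point below `1`, and some map moves it up while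
keeping it below `1`. -/
theorem ConditionA.not_finite {Γ : Set C(unitInterval, unitInterval)} (hA : ConditionA Γ)
    {C : Set unitInterval} (hne : C.Nonempty) (hinv : ∀ g ∈ Γ, ∀ x ∈ C, g x ∈ C) :
    ¬ C.Finite := by
  intro hC
  have h0 := hA.zero_mem hC.isClosed hne hinv
  obtain ⟨c, hc, hmax⟩ := (hC.inter_of_left (Iio 1)).isCompact.exists_isGreatest
    ⟨0, h0, mem_Iio.2 zero_lt_one⟩
  obtain ⟨h, hh, hhc⟩ := hA.2 c ⟨c.2.1, hc.2⟩
  exact absurd (hmax ⟨hinv h hh.1 c hc.1, hhc.2⟩) (not_le.2 hhc.1)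

variable {Γ : Set C(unitInterval, unitInterval)} [MeasurableSpace Γ] [BorelSpace Γ] {μ : Measure Γ}

theorem MuInvariant.nullSingletonClass [IsProbabilityMeasure μ] (hsupp : μ.support = univ)
    (hA : ConditionA Γ) (hinj : MuInjective μ) {ν : Measure unitInterval}
    [IsProbabilityMeasure ν] (hν : MuInvariant μ ν) : NullSingletonClass ν := by
  classical
  by_contra hna
  obtain ⟨x₀, hx₀⟩ : ∃ x, ν {x} ≠ 0 := by
    by_contra! h
    exact hna ⟨h⟩
  have hfin : ∀ ε : ENNReal, 0 < ε → {y | ε ≤ ν {y}}.Finite := fun ε hε =>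
    Measure.finite_const_le_meas_of_disjoint_iUnion ν hε (fun y => measurableSet_singleton y)
      (fun y z hyz => disjoint_singleton.2 hyz) (measure_ne_top _ _)
  obtain ⟨x₁, hx₁, hmax⟩ := (hfin _ (pos_iff_ne_zero.2 hx₀)).exists_maximalFor (fun y => ν {y}) _
    ⟨x₀, le_refl (ν {x₀})⟩
  set m := ν {x₁} with hm
  have hm0 : m ≠ 0 := fun h => hx₀ (le_antisymm (h ▸ hx₁) bot_le)
  have hmtop : m ≠ ⊤ := measure_ne_top _ _
  have hle : ∀ y, ν {y} ≤ m := fun y => by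
    rcases le_total (ν {y}) m with h | h
    · exact h
    · exact hmax (le_trans hx₁ h) h
  set S : Set unitInterval := {y | m ≤ ν {y}} with hS
  have hSfin : S.Finite := hfin m (pos_iff_ne_zero.2 hm0)
  -- Only finitely many points have mass at least `m / 2`, so masses off `S` stay uniformly below
  -- `m`.
  obtain ⟨m', hm', hgap⟩ : ∃ m' < m, ∀ y ∉ S, ν {y} ≤ m' := by
    have hF := (hfin (m / 2) (ENNReal.half_pos hm0)).subset (sdiff_subset (t := S))
    refine ⟨max (m / 2) (hF.toFinset.sup fun y => ν {y}),
      max_lt (ENNReal.half_lt_self hm0 hmtop)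
        ((Finset.sup_lt_iff (pos_iff_ne_zero.2 hm0)).2 fun y hy => ?_), fun y hy => ?_⟩
    · rw [hF.mem_toFinset] at hy
      exact not_le.1 hy.2
    · rcases le_total (ν {y}) (m / 2) with h | h
      · exact le_max_of_le_left h
      · exact le_max_of_le_right (Finset.le_sup (f := fun y => ν {y})
          (hF.mem_toFinset.2 ⟨h, hy⟩))
  -- The maximum principle needs closed sets, so the complement of `S` is exhausted by countably
  -- many of them.
  obtain ⟨K, hKc, hKS, hKU, -⟩ := hSfin.isClosed.isOpen_compl.exists_iUnion_isClosed
  have hpre : ∀ x ∈ S, ∀ᵐ g : Γ ∂μ, g.1 ⁻¹' {x} ⊆ S := by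
    intro x hx
    have : ∀ n, ∀ᵐ g : Γ ∂μ, ∀ y ∈ K n, g.1 y ≠ x := fun n => by
      refine ae_forall_mem_apply_ne hinj (w := fun y => ν {y}) (u := fun g => ν (g.1 ⁻¹' {x}))
        (δ := m - m') hm0 hmtop (tsub_pos_iff_lt.2 hm').ne' (hKc n) hle (fun y hy => ?_)
        (fun g T hT => ?_) ?_
      · calc ν {y} + (m - m') ≤ m' + (m - m') := by gcongr; exact hgap y (hKS n hy)
          _ = m := add_tsub_cancel_of_le hm'.le
      · rw [← hT, ← biUnion_of_singleton (T : Set unitInterval)]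
        exact measure_biUnion_finset_le _ _
      · rw [← hν {x} (measurableSet_singleton x)]
        exact hx
    filter_upwards [ae_all_iff.2 this] with g hg y hy
    by_contra hyS
    rw [← mem_compl_iff, ← hKU] at hyS
    obtain ⟨n, hn⟩ := mem_iUnion.1 hyS
    exact hg n y hn hy
  have hpreS : ∀ᵐ g : Γ ∂μ, g.1 ⁻¹' S ⊆ S := by
    filter_upwards [(ae_ball_iff hSfin.countable).2 hpre] with g hg y hy
    exact hg _ hy rfl
  have hSm := hSfin.measurableSet
  -- The preimage of `S` lies in `S` and has the same mass on average, so almost surely it misses no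
  -- atom of `S`.
  have heq : ∀ᵐ g : Γ ∂μ, ν (g.1 ⁻¹' S) = ν S := by
    refine ae_eq_of_ae_le_of_lintegral_le (g := fun _ => ν S) ?_ ?_ aemeasurable_const ?_
    · filter_upwards [hpreS] with g hg using measure_mono hg
    · rw [← hν S hSm]; exact measure_ne_top _ _
    · rw [← hν S hSm]; simp
  have hfwd : ∀ x ∈ S, ∀ᵐ g : Γ ∂μ, g.1 x ∈ S := by
    intro x hx
    filter_upwards [hpreS, heq] with g hg he
    by_contra hgx
    have hsub : insert x (g.1 ⁻¹' S) ⊆ S := insert_subset hx hg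
    have h2 : ν {x} + ν (g.1 ⁻¹' S) ≤ ν (g.1 ⁻¹' S) := by
      rw [← measure_union (by simpa using hgx) (hSm.preimage g.1.continuous.measurable)]
      exact (measure_mono hsub).trans he.ge
    refine absurd h2 (not_le.2 ?_)
    rw [add_comm]
    exact ENNReal.lt_add_right (measure_ne_top _ _) (fun h => hm0 (le_antisymm (h ▸ hx) bot_le))
  exact hA.not_finite ⟨x₁, le_refl m⟩ (fun g hg x hx =>
    forall_apply_mem_of_ae hsupp hSfin.isClosed (hfwd x hx) ⟨g, hg⟩) hSfin

end Atoms

/-! ### Mass differences of sets with finite frontier -/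

section MassDifference

theorem subset_or_disjoint_of_disjoint_frontier {X : Type*} [TopologicalSpace X] {s A : Set X}
    (hs : IsPreconnected s) (h : ∀ y ∈ s, y ∉ frontier A) : s ⊆ A ∨ Disjoint s A := by
  rcases hs.subset_or_subset isOpen_interior isClosed_closure.isOpen_compl
    (disjoint_compl_right.mono_left interior_subset_closure) (fun y hy => by
      by_contra hn
      rw [mem_union, not_or, mem_compl_iff, not_not] at hn
      exact h y hy ⟨hn.2, hn.1⟩) with h | h
  · exact Or.inl (h.trans interior_subset)
  · exact Or.inr (disjoint_left.2 fun y hy hyA => h hy (subset_closure hyA))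

/-- The difference of the masses that two measures give to a set. -/
noncomputable def massDiff (ν₁ ν₂ : Measure unitInterval) (A : Set unitInterval) : ℝ :=
  ν₁.real A - ν₂.real A

variable (ν₁ ν₂ : Measure unitInterval)

theorem massDiff_swap (A : Set unitInterval) : massDiff ν₂ ν₁ A = -massDiff ν₁ ν₂ A := by
  simp [massDiff]

theorem massDiff_congr {A B : Set unitInterval} (h₁ : A =ᵐ[ν₁] B) (h₂ : A =ᵐ[ν₂] B) :
    massDiff ν₁ ν₂ A = massDiff ν₁ ν₂ B := by
  rw [massDiff, massDiff, measureReal_congr h₁, measureReal_congr h₂]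

@[simp]
theorem massDiff_empty : massDiff ν₁ ν₂ ∅ = 0 := by simp [massDiff]

variable [IsProbabilityMeasure ν₁] [IsProbabilityMeasure ν₂]

@[simp]
theorem massDiff_univ : massDiff ν₁ ν₂ univ = 0 := by simp [massDiff]

theorem abs_massDiff_le_one (A : Set unitInterval) : |massDiff ν₁ ν₂ A| ≤ 1 := by
  have h₁ : ν₁.real A ≤ 1 := measureReal_le_one
  have h₂ : ν₂.real A ≤ 1 := measureReal_le_one
  have h₃ : 0 ≤ ν₁.real A := measureReal_nonneg
  have h₄ : 0 ≤ ν₂.real A := measureReal_nonneg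
  rw [massDiff, abs_le]
  constructor <;> linarith

theorem massDiff_union {A B : Set unitInterval} (h : Disjoint A B) (hB : MeasurableSet B) :
    massDiff ν₁ ν₂ (A ∪ B) = massDiff ν₁ ν₂ A + massDiff ν₁ ν₂ B := by
  rw [massDiff, measureReal_union h hB, measureReal_union h hB, massDiff, massDiff]
  ring

theorem massDiff_union_add_inter (A : Set unitInterval) {B : Set unitInterval}
    (hB : MeasurableSet B) :
    massDiff ν₁ ν₂ (A ∪ B) + massDiff ν₁ ν₂ (A ∩ B) = massDiff ν₁ ν₂ A + massDiff ν₁ ν₂ B := by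
  have h₁ := measureReal_union_add_inter (μ := ν₁) (s := A) hB
  have h₂ := measureReal_union_add_inter (μ := ν₂) (s := A) hB
  rw [massDiff, massDiff, massDiff, massDiff]
  linarith

variable [NullSingletonClass ν₁] [NullSingletonClass ν₂]

/-- Dominated convergence: without an atom at `y`, the indicators of `Iic t` converge almost
everywhere as `t → y`. -/
theorem continuous_measureReal_Iic (ν : Measure unitInterval) [IsProbabilityMeasure ν]
    [NullSingletonClass ν] : Continuous fun y => ν.real (Iic y) := by
  have heq : (fun y => ν.real (Iic y)) = fun y => ∫ z, (Iic y).indicator (fun _ => (1 : ℝ)) z ∂ν := by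
    ext y
    rw [integral_indicator_const _ measurableSet_Iic]
    simp
  rw [heq, continuous_iff_continuousAt]
  intro y
  refine continuousAt_of_dominated (bound := fun _ => 1)
    (.of_forall fun t => (measurable_const.indicator measurableSet_Iic).aestronglyMeasurable)
    (.of_forall fun t => .of_forall fun z => ?_) (integrable_const _) ?_
  · by_cases hz : z ∈ Iic t <;> simp [indicator, hz]
  · have hne : ∀ᵐ z ∂ν, z ≠ y := by
      rw [ae_iff]
      simp
    filter_upwards [hne] with z hz
    refine continuousAt_const.congr (f := fun _ => (Iic y).indicator (fun _ => (1 : ℝ)) z) ?_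
    rcases lt_or_gt_of_ne hz with h | h
    · filter_upwards [lt_mem_nhds h] with t ht
      rw [indicator_of_mem (mem_Iic.2 h.le), indicator_of_mem (mem_Iic.2 ht.le)]
    · filter_upwards [gt_mem_nhds h] with t ht
      rw [indicator_of_notMem (by simpa using h), indicator_of_notMem (by simpa using ht)]

theorem continuous_massDiff_Iic : Continuous fun y => massDiff ν₁ ν₂ (Iic y) :=
  (continuous_measureReal_Iic ν₁).sub (continuous_measureReal_Iic ν₂)

/-- Induction on the cut points from the left. The digit `e` records whether the last interval
before `t` lies in `A`; knowing that it is `0` or `1` keeps the next coefficient, a difference of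
two digits, in `{-1, 0, 1}`. -/
theorem exists_massDiff_inter_Iic_eq_sum {A : Set unitInterval} (hA : MeasurableSet A)
    (T : Finset unitInterval) (t : unitInterval) (hT : ∀ y ∈ T, y < t)
    (hfr : ∀ y ∈ frontier A, y < t → y ∈ T) :
    ∃ (c : unitInterval → ℤ) (e : ℤ), (∀ y, |c y| ≤ 1) ∧ (e = 0 ∨ e = 1) ∧
      massDiff ν₁ ν₂ (A ∩ Iic t) =
        ∑ y ∈ T, c y * massDiff ν₁ ν₂ (Iic y) + e * massDiff ν₁ ν₂ (Iic t) := by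
  induction T using Finset.induction_on_max generalizing t with
  | empty =>
    have hcongr : massDiff ν₁ ν₂ (A ∩ Iic t) = massDiff ν₁ ν₂ (A ∩ Iio t) :=
      massDiff_congr _ _ ((ae_eq_refl A).inter Iio_ae_eq_Iic.symm)
        ((ae_eq_refl A).inter Iio_ae_eq_Iic.symm)
    rcases subset_or_disjoint_of_disjoint_frontier (A := A) (ordConnected_Iio (a := t)).isPreconnected
      (fun y hy hyA => absurd (hfr y hyA hy) (Finset.notMem_empty y)) with h | h
    · refine ⟨0, 1, by simp, Or.inr rfl, ?_⟩
      rw [hcongr, inter_eq_right.2 h, massDiff_congr _ _ Iio_ae_eq_Iic Iio_ae_eq_Iic]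
      simp
    · refine ⟨0, 0, by simp, Or.inl rfl, ?_⟩
      rw [hcongr, h.symm.inter_eq]
      simp
  | insert s T hs ih =>
    have hst : s < t := hT s (Finset.mem_insert_self s T)
    have hsT : s ∉ T := fun h => lt_irrefl s (hs s h)
    obtain ⟨c, e, hc, he, heq⟩ := ih s hs fun y hy hys =>
      (Finset.mem_insert.1 (hfr y hy (hys.trans hst))).resolve_left hys.ne
    have hsplit : massDiff ν₁ ν₂ (A ∩ Iic t) =
        massDiff ν₁ ν₂ (A ∩ Iic s) + massDiff ν₁ ν₂ (A ∩ Ioc s t) := by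
      rw [← massDiff_union _ _ _ (hA.inter measurableSet_Ioc), ← inter_union_distrib_left,
        Iic_union_Ioc_eq_Iic hst.le]
      exact (Iic_disjoint_Ioc le_rfl).mono inter_subset_right inter_subset_right
    have hsplit' : massDiff ν₁ ν₂ (Iic t) =
        massDiff ν₁ ν₂ (Iic s) + massDiff ν₁ ν₂ (Ioc s t) := by
      rw [← massDiff_union _ _ (Iic_disjoint_Ioc le_rfl) measurableSet_Ioc,
        Iic_union_Ioc_eq_Iic hst.le]
    have hcongr : massDiff ν₁ ν₂ (A ∩ Ioc s t) = massDiff ν₁ ν₂ (A ∩ Ioo s t) :=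
      massDiff_congr _ _ ((ae_eq_refl A).inter Ioo_ae_eq_Ioc.symm)
        ((ae_eq_refl A).inter Ioo_ae_eq_Ioc.symm)
    obtain ⟨e', he', heq'⟩ : ∃ e' : ℤ, (e' = 0 ∨ e' = 1) ∧ massDiff ν₁ ν₂ (A ∩ Ioc s t) =
        e' * (massDiff ν₁ ν₂ (Iic t) - massDiff ν₁ ν₂ (Iic s)) := by
      rcases subset_or_disjoint_of_disjoint_frontier (A := A)
        (ordConnected_Ioo (a := s) (b := t)).isPreconnected (fun y hy hyA =>
          (Finset.mem_insert.1 (hfr y hyA hy.2)).elim hy.1.ne' fun h =>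
            (hs y h).not_gt hy.1) with h | h
      · refine ⟨1, Or.inr rfl, ?_⟩
        rw [hcongr, inter_eq_right.2 h, massDiff_congr _ _ Ioo_ae_eq_Ioc Ioo_ae_eq_Ioc, hsplit']
        simp
      · refine ⟨0, Or.inl rfl, ?_⟩
        rw [hcongr, h.symm.inter_eq]
        simp
    refine ⟨Function.update c s (e - e'), e', fun y => ?_, he', ?_⟩
    · rcases eq_or_ne y s with rfl | hy
      · rw [Function.update_self]
        rcases he with rfl | rfl <;> rcases he' with rfl | rfl <;> simp
      · rw [Function.update_of_ne hy]
        exact hc y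
    · have hsum : ∑ y ∈ T, (Function.update c s (e - e') y : ℝ) * massDiff ν₁ ν₂ (Iic y) =
          ∑ y ∈ T, c y * massDiff ν₁ ν₂ (Iic y) := Finset.sum_congr rfl fun y hy => by
        rw [Function.update_of_ne (ne_of_mem_of_not_mem hy hsT)]
      rw [Finset.sum_insert hsT, hsum, Function.update_self, hsplit, heq, heq']
      push_cast
      ring

/-- A set with finite frontier is, up to null sets, a union of finitely many intervals, so that its
mass is an alternating sum of values of the distribution function on its frontier. -/
theorem exists_massDiff_eq_sum {A : Set unitInterval} (hA : MeasurableSet A)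
    (T : Finset unitInterval) (hfr : frontier A ⊆ T) :
    ∃ c : unitInterval → ℤ, (∀ y, |c y| ≤ 1) ∧
      massDiff ν₁ ν₂ A = ∑ y ∈ T, c y * massDiff ν₁ ν₂ (Iic y) := by
  classical
  -- Cutting at `1` costs nothing: both measures have total mass one, so the term at `Iic 1`
  -- vanishes.
  obtain ⟨c, e, hc, -, heq⟩ := exists_massDiff_inter_Iic_eq_sum ν₁ ν₂ hA (T.filter (· < 1)) 1
    (fun y hy => (Finset.mem_filter.1 hy).2) fun y hy hy1 =>
      Finset.mem_filter.2 ⟨hfr hy, hy1⟩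
  have h1 : (Iic 1 : Set unitInterval) = univ := eq_univ_of_forall fun y => y.2.2
  rw [h1, massDiff_univ, inter_univ, mul_zero, add_zero, Finset.sum_filter] at heq
  refine ⟨fun y => if y < 1 then c y else 0, fun y => ?_, ?_⟩
  · dsimp only
    split_ifs
    · exact hc y
    · simp
  · rw [heq]
    refine Finset.sum_congr rfl fun y _ => ?_
    by_cases hy : y < 1 <;> simp only [hy, if_true, if_false, Int.cast_zero, zero_mul]

theorem abs_massDiff_le_sum {A : Set unitInterval} (hA : MeasurableSet A)
    (T : Finset unitInterval) (hfr : frontier A ⊆ T) :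
    |massDiff ν₁ ν₂ A| ≤ ∑ y ∈ T, |massDiff ν₁ ν₂ (Iic y)| := by
  obtain ⟨c, hc, heq⟩ := exists_massDiff_eq_sum ν₁ ν₂ hA T hfr
  rw [heq]
  refine (Finset.abs_sum_le_sum_abs _ _).trans (Finset.sum_le_sum fun y _ => ?_)
  rw [abs_mul]
  refine mul_le_of_le_one_left (abs_nonneg _) ?_
  exact_mod_cast hc y

/-- All terms of the alternating sum are `0` or `± M`. This discreteness later makes a maximum
exist. -/
theorem exists_int_massDiff_eq_mul {A : Set unitInterval} (hA : MeasurableSet A)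
    (hfin : (frontier A).Finite) {M : ℝ} (hM : ∀ y ∈ frontier A, |massDiff ν₁ ν₂ (Iic y)| = M) :
    ∃ k : ℤ, massDiff ν₁ ν₂ A = k * M := by
  obtain ⟨c, hc, heq⟩ := exists_massDiff_eq_sum ν₁ ν₂ hA hfin.toFinset (by simp)
  have hsign : ∀ y, ∃ s : ℤ, y ∈ frontier A → massDiff ν₁ ν₂ (Iic y) = s * M := fun y => by
    by_cases hy : y ∈ frontier A
    · rcases abs_choice (massDiff ν₁ ν₂ (Iic y)) with h | h
      · exact ⟨1, fun _ => by rw [← hM y hy, h]; simp⟩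
      · exact ⟨-1, fun _ => by rw [← hM y hy, h]; simp⟩
    · exact ⟨0, fun h => absurd h hy⟩
  choose s hs using hsign
  refine ⟨∑ y ∈ hfin.toFinset, c y * s y, ?_⟩
  rw [heq]
  push_cast
  rw [Finset.sum_mul]
  refine Finset.sum_congr rfl fun y hy => ?_
  rw [hs y (hfin.mem_toFinset.1 hy)]
  ring

end MassDifference

/-! ### Extremal points of the difference of distribution functions -/

section Uniqueness

variable {Γ : Set C(unitInterval, unitInterval)} [MeasurableSpace Γ] [BorelSpace Γ] {μ : Measure Γ}

theorem MuInvariant.measureReal_eq {ν : Measure unitInterval} [IsProbabilityMeasure ν]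
    (hν : MuInvariant μ ν) {A : Set unitInterval} (hA : MeasurableSet A) :
    ν.real A = ∫ g : Γ, ν.real (g.1 ⁻¹' A) ∂μ := by
  simp only [measureReal_def]
  rw [integral_toReal (measurable_measure_preimage ν hA).aemeasurable
    (.of_forall fun g => measure_lt_top _ _), ← hν A hA]

variable [IsProbabilityMeasure μ]

theorem integrable_measureReal_preimage (ν : Measure unitInterval) [IsProbabilityMeasure ν]
    {A : Set unitInterval} (hA : MeasurableSet A) :
    Integrable (fun g : Γ => ν.real (g.1 ⁻¹' A)) μ :=
  (integrable_const (1 : ℝ)).mono'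
    (measurable_measure_preimage ν hA).ennreal_toReal.aestronglyMeasurable
    (.of_forall fun g => by
      rw [Real.norm_of_nonneg measureReal_nonneg]
      exact measureReal_le_one)

variable {ν₁ ν₂ : Measure unitInterval} [IsProbabilityMeasure ν₁] [IsProbabilityMeasure ν₂]

theorem integrable_massDiff_preimage {A : Set unitInterval} (hA : MeasurableSet A) :
    Integrable (fun g : Γ => massDiff ν₁ ν₂ (g.1 ⁻¹' A)) μ :=
  (integrable_measureReal_preimage ν₁ hA).sub (integrable_measureReal_preimage ν₂ hA)

theorem MuInvariant.massDiff_eq (hν₁ : MuInvariant μ ν₁) (hν₂ : MuInvariant μ ν₂)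
    {A : Set unitInterval} (hA : MeasurableSet A) :
    massDiff ν₁ ν₂ A = ∫ g : Γ, massDiff ν₁ ν₂ (g.1 ⁻¹' A) ∂μ := by
  simp only [massDiff]
  rw [integral_sub (integrable_measureReal_preimage ν₁ hA) (integrable_measureReal_preimage ν₂ hA),
    ← hν₁.measureReal_eq hA, ← hν₂.measureReal_eq hA]

variable [NullSingletonClass ν₁] [NullSingletonClass ν₂]

/-- The frontier of the preimage of `Iic x` lies in the fibre over `x`, so its mass difference is
bounded by the fibre sum of `|D|`; by invariance the mean of its absolute value is at least `M`. The
maximum principle applies to closed sets exhausting `{|D| < M}`. -/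
theorem ae_preimage_singleton_subset_extremal (hinj : MuInjective μ) (hν₁ : MuInvariant μ ν₁)
    (hν₂ : MuInvariant μ ν₂) {M : ℝ} (hM : 0 < M) (hle : ∀ y, |massDiff ν₁ ν₂ (Iic y)| ≤ M)
    {x : unitInterval} (hx : |massDiff ν₁ ν₂ (Iic x)| = M) :
    ∀ᵐ g : Γ ∂μ, ∀ y, g.1 y = x → |massDiff ν₁ ν₂ (Iic y)| = M := by
  have hK : ∀ n : ℕ, ∀ᵐ g : Γ ∂μ,
      ∀ y ∈ {y | |massDiff ν₁ ν₂ (Iic y)| + 1 / ((n : ℝ) + 1) ≤ M}, g.1 y ≠ x := by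
    intro n
    have hn : (0 : ℝ) < 1 / ((n : ℝ) + 1) := by positivity
    refine ae_forall_mem_apply_ne hinj (M := ENNReal.ofReal M)
      (δ := ENNReal.ofReal (1 / ((n : ℝ) + 1)))
      (w := fun y => ENNReal.ofReal |massDiff ν₁ ν₂ (Iic y)|)
      (u := fun g => ENNReal.ofReal |massDiff ν₁ ν₂ (g.1 ⁻¹' Iic x)|)
      (ENNReal.ofReal_pos.2 hM).ne' ENNReal.ofReal_ne_top (ENNReal.ofReal_pos.2 hn).ne' ?_
      (fun y => ENNReal.ofReal_le_ofReal (hle y)) (fun y hy => ?_) (fun g T hT => ?_) ?_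
    · exact isClosed_le ((continuous_massDiff_Iic ν₁ ν₂).abs.add continuous_const) continuous_const
    · rw [← ENNReal.ofReal_add (abs_nonneg _) hn.le]
      exact ENNReal.ofReal_le_ofReal hy
    · rw [← ENNReal.ofReal_sum_of_nonneg fun y _ => abs_nonneg _]
      refine ENNReal.ofReal_le_ofReal (abs_massDiff_le_sum ν₁ ν₂
        (measurableSet_Iic.preimage g.1.continuous.measurable) T ?_)
      rw [hT]
      exact (g.1.continuous.frontier_preimage_subset _).trans
        (preimage_mono (frontier_Iic_subset x))
    · have hint := integrable_massDiff_preimage (μ := μ) (ν₁ := ν₁) (ν₂ := ν₂)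
        (measurableSet_Iic (a := x))
      rw [← ofReal_integral_eq_lintegral_ofReal hint.abs (.of_forall fun g => abs_nonneg _), ← hx,
        hν₁.massDiff_eq hν₂ measurableSet_Iic]
      exact ENNReal.ofReal_le_ofReal abs_integral_le_integral_abs
  filter_upwards [ae_all_iff.2 hK] with g hg y hy
  by_contra hne
  obtain ⟨n, hn⟩ := exists_nat_one_div_lt (sub_pos.2 ((hle y).lt_of_ne hne))
  exact hg n y (show _ + _ ≤ M by linarith) hy

/-- Closed sets with finitely many boundary points, at each of which the difference of the
distribution functions has absolute value `M`. -/
structure Admissible (ν₁ ν₂ : Measure unitInterval) (M : ℝ) (A : Set unitInterval) : Prop where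
  isClosed : IsClosed A
  finite : (frontier A).Finite
  abs_eq : ∀ y ∈ frontier A, |massDiff ν₁ ν₂ (Iic y)| = M

/-- Admissible sets for which the mass difference is maximal. -/
def IsMaximizer (ν₁ ν₂ : Measure unitInterval) (M : ℝ) (A : Set unitInterval) : Prop :=
  Admissible ν₁ ν₂ M A ∧ ∀ B, Admissible ν₁ ν₂ M B → massDiff ν₁ ν₂ B ≤ massDiff ν₁ ν₂ A

end Uniqueness
-- Structure of the family of maximizers
section Maximizers

variable {ν₁ ν₂ : Measure unitInterval} {M : ℝ} {A B : Set unitInterval}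

theorem Admissible.inter (hA : Admissible ν₁ ν₂ M A) (hB : Admissible ν₁ ν₂ M B) :
    Admissible ν₁ ν₂ M (A ∩ B) := by
  have hsub : frontier (A ∩ B) ⊆ frontier A ∪ frontier B :=
    (frontier_inter_subset A B).trans (union_subset_union inter_subset_left inter_subset_right)
  exact ⟨hA.isClosed.inter hB.isClosed, (hA.finite.union hB.finite).subset hsub,
    fun y hy => (hsub hy).elim (hA.abs_eq y) (hB.abs_eq y)⟩

theorem Admissible.union (hA : Admissible ν₁ ν₂ M A) (hB : Admissible ν₁ ν₂ M B) :
    Admissible ν₁ ν₂ M (A ∪ B) := by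
  have hsub : frontier (A ∪ B) ⊆ frontier A ∪ frontier B :=
    (frontier_union_subset A B).trans (union_subset_union inter_subset_left inter_subset_right)
  exact ⟨hA.isClosed.union hB.isClosed, (hA.finite.union hB.finite).subset hsub,
    fun y hy => (hsub hy).elim (hA.abs_eq y) (hB.abs_eq y)⟩

theorem admissible_Ici {a : unitInterval} (ha : |massDiff ν₁ ν₂ (Iic a)| = M) :
    Admissible ν₁ ν₂ M (Ici a) := by
  refine ⟨isClosed_Ici, (finite_singleton a).subset (frontier_Ici_subset a), fun y hy => ?_⟩
  rw [mem_singleton_iff.1 (frontier_Ici_subset a hy)]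
  exact ha

variable [IsProbabilityMeasure ν₁] [IsProbabilityMeasure ν₂]

/-- Modularity: the union cannot exceed the maximum, so the intersection cannot fall short of it. -/
theorem IsMaximizer.inter (hA : IsMaximizer ν₁ ν₂ M A) (hB : IsMaximizer ν₁ ν₂ M B) :
    IsMaximizer ν₁ ν₂ M (A ∩ B) := by
  refine ⟨hA.1.inter hB.1, fun C hC => ?_⟩
  have h := massDiff_union_add_inter ν₁ ν₂ A hB.1.isClosed.measurableSet
  have h₁ := hA.2 _ (hA.1.union hB.1)
  have h₂ := hB.2 C hC
  linarith

variable [NullSingletonClass ν₁] [NullSingletonClass ν₂]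

/-- The values are integer multiples of `M` and bounded by `1`. -/
theorem exists_isMaximizer (hM : 0 < M) {A₀ : Set unitInterval}
    (h₀ : Admissible ν₁ ν₂ M A₀) : ∃ A, IsMaximizer ν₁ ν₂ M A := by
  have hint : ∀ A, Admissible ν₁ ν₂ M A → ∃ k : ℤ, massDiff ν₁ ν₂ A = k * M := fun A hA =>
    exists_int_massDiff_eq_mul ν₁ ν₂ hA.isClosed.measurableSet hA.finite hA.abs_eq
  obtain ⟨k, ⟨A, hA, hk⟩, hmax⟩ := Int.exists_greatest_of_bdd
    (P := fun k : ℤ => ∃ A, Admissible ν₁ ν₂ M A ∧ massDiff ν₁ ν₂ A = k * M)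
    ⟨⌈1 / M⌉, fun k ⟨A, _, hk⟩ => by
      have h1 := (le_abs_self _).trans (abs_massDiff_le_one ν₁ ν₂ A)
      rw [hk, ← le_div_iff₀ hM] at h1
      exact_mod_cast h1.trans (Int.le_ceil _)⟩
    ((hint A₀ h₀).imp fun k hk => ⟨A₀, h₀, hk⟩)
  refine ⟨A, hA, fun B hB => ?_⟩
  obtain ⟨l, hl⟩ := hint B hB
  have hlk : (l : ℝ) ≤ k := by exact_mod_cast hmax l ⟨B, hB, hl⟩
  rw [hl, hk]
  gcongr

/-- No frontier point of `A` lies below `a`, so `A` contains `Iio a` or misses it. The removed part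
has mass difference `-M` or `0`, and removing it loses nothing. -/
theorem IsMaximizer.inter_Ici (hA : IsMaximizer ν₁ ν₂ M A) (hM : 0 < M) {a : unitInterval}
    (ha : massDiff ν₁ ν₂ (Iic a) = -M) (hmin : ∀ y, |massDiff ν₁ ν₂ (Iic y)| = M → a ≤ y) :
    IsMaximizer ν₁ ν₂ M (A ∩ Ici a) := by
  have hadm := hA.1.inter (admissible_Ici (by rw [ha, abs_neg, abs_of_pos hM]))
  refine ⟨hadm, fun B hB => (hA.2 B hB).trans ?_⟩
  have hsplit : massDiff ν₁ ν₂ A = massDiff ν₁ ν₂ (A ∩ Iio a) + massDiff ν₁ ν₂ (A ∩ Ici a) := by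
    rw [← massDiff_union _ _ _ (hA.1.isClosed.measurableSet.inter measurableSet_Ici),
      ← inter_union_distrib_left, Iio_union_Ici, inter_univ]
    exact (Iio_disjoint_Ici le_rfl).mono inter_subset_right inter_subset_right
  rw [hsplit]
  rcases subset_or_disjoint_of_disjoint_frontier (A := A) (ordConnected_Iio (a := a)).isPreconnected
    (fun y hy hyA => (hmin y (hA.1.abs_eq y hyA)).not_gt hy) with h | h
  · rw [inter_eq_right.2 h, massDiff_congr _ _ Iio_ae_eq_Iic Iio_ae_eq_Iic, ha]
    linarith
  · rw [h.symm.inter_eq, massDiff_empty, zero_add]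

end Maximizers

/-! ### Uniqueness of the invariant measure -/

section UniqueErgodicity

variable {Γ : Set C(unitInterval, unitInterval)} [MeasurableSpace Γ] [BorelSpace Γ] {μ : Measure Γ}
  [IsProbabilityMeasure μ] {ν₁ ν₂ : Measure unitInterval} [IsProbabilityMeasure ν₁]
  [IsProbabilityMeasure ν₂] [NullSingletonClass ν₁] [NullSingletonClass ν₂] {M : ℝ}

/-- Almost every preimage is admissible, so its mass difference is at most the maximum; by
invariance its mean is the maximum, hence equality holds almost surely. -/
theorem IsMaximizer.ae_preimage (hΓ : ∀ g ∈ Γ, PiecewiseMonotone g) (hinj : MuInjective μ)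
    (hν₁ : MuInvariant μ ν₁) (hν₂ : MuInvariant μ ν₂) (hM : 0 < M)
    (hle : ∀ y, |massDiff ν₁ ν₂ (Iic y)| ≤ M) {A : Set unitInterval}
    (hA : IsMaximizer ν₁ ν₂ M A) : ∀ᵐ g : Γ ∂μ, IsMaximizer ν₁ ν₂ M (g.1 ⁻¹' A) := by
  have hAm := hA.1.isClosed.measurableSet
  have hadm : ∀ᵐ g : Γ ∂μ, Admissible ν₁ ν₂ M (g.1 ⁻¹' A) := by
    filter_upwards [(ae_ball_iff hA.1.finite.countable).2 fun x _ =>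
        ae_finite_preimage_singleton hΓ hinj x,
      (ae_ball_iff hA.1.finite.countable).2 fun x hx =>
        ae_preimage_singleton_subset_extremal hinj hν₁ hν₂ hM hle (hA.1.abs_eq x hx)] with g hg₁ hg₂
    have hsub := g.1.continuous.frontier_preimage_subset A
    refine ⟨hA.1.isClosed.preimage g.1.continuous, ?_, fun y hy => hg₂ _ (hsub hy) y rfl⟩
    refine (hA.1.finite.biUnion hg₁).subset fun y hy => ?_
    exact mem_biUnion (hsub hy) (mem_singleton _)
  have hint := integrable_massDiff_preimage (μ := μ) (ν₁ := ν₁) (ν₂ := ν₂) hAm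
  have hle' : (fun g : Γ => massDiff ν₁ ν₂ (g.1 ⁻¹' A)) ≤ᵐ[μ] fun _ => massDiff ν₁ ν₂ A := by
    filter_upwards [hadm] with g hg using hA.2 _ hg
  have heq := (integral_eq_iff_of_ae_le hint (integrable_const _) hle').1
    (by rw [← hν₁.massDiff_eq hν₂ hAm]; simp)
  filter_upwards [hadm, heq] with g hg hge
  exact ⟨hg, fun B hB => (hA.2 B hB).trans hge.ge⟩

theorem massDiff_Iic_ne_neg (hΓ : ∀ g ∈ Γ, PiecewiseMonotone g) (hsupp : μ.support = univ)
    (hA : ConditionA Γ) (hinj : MuInjective μ) (hν₁ : MuInvariant μ ν₁) (hν₂ : MuInvariant μ ν₂)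
    (hM : 0 < M) (hle : ∀ y, |massDiff ν₁ ν₂ (Iic y)| ≤ M) {a : unitInterval}
    (hmin : ∀ y, |massDiff ν₁ ν₂ (Iic y)| = M → a ≤ y) : massDiff ν₁ ν₂ (Iic a) ≠ -M := by
  intro ha
  have hIci : Admissible ν₁ ν₂ M (Ici a) := admissible_Ici (by rw [ha, abs_neg, abs_of_pos hM])
  obtain ⟨A, hAmax⟩ := exists_isMaximizer hM hIci
  have ha0 : a ≠ 0 := by
    rintro rfl
    have h0 : (Iic 0 : Set unitInterval) = {0} := by
      ext y
      exact ⟨fun h => le_antisymm h y.2.1, fun h => h.le⟩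
    rw [h0, massDiff, measureReal_def, measureReal_def, measure_singleton, measure_singleton] at ha
    simp only [ENNReal.toReal_zero, sub_self] at ha
    linarith
  -- The set `Ici a` has mass difference `M > 0`, so the empty set is not a maximizer.
  have hpos : ∀ B, IsMaximizer ν₁ ν₂ M B → B.Nonempty := by
    intro B hB
    by_contra hne
    rw [not_nonempty_iff_eq_empty] at hne
    have h1 := hB.2 _ hIci
    have h2 : massDiff ν₁ ν₂ univ = massDiff ν₁ ν₂ (Iio a) + massDiff ν₁ ν₂ (Ici a) := by
      rw [← massDiff_union _ _ (Iio_disjoint_Ici le_rfl) measurableSet_Ici, Iio_union_Ici]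
    rw [massDiff_univ, massDiff_congr _ _ Iio_ae_eq_Iic Iio_ae_eq_Iic, ha] at h2
    rw [hne, massDiff_empty] at h1
    linarith
  have hne : (⋂₀ {B | IsMaximizer ν₁ ν₂ M B}).Nonempty := by
    have : Nonempty {B | IsMaximizer ν₁ ν₂ M B} := ⟨⟨A, hAmax⟩⟩
    refine IsCompact.nonempty_sInter_of_directed_nonempty_isCompact_isClosed (S := {B | IsMaximizer ν₁ ν₂ M B}) ?_
      (fun B hB => hpos B hB) (fun B hB => hB.1.isClosed.isCompact) (fun B hB => hB.1.isClosed)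
    exact fun B hB C hC => ⟨B ∩ C, IsMaximizer.inter hB hC, inter_subset_left, inter_subset_right⟩
  have hcl : IsClosed (⋂₀ {B | IsMaximizer ν₁ ν₂ M B}) :=
    isClosed_sInter fun B hB => hB.1.isClosed
  -- A point common to all maximizers lies in almost every preimage of `B`, so its image lies in
  -- `B`, first for almost every map and then for every map.
  have h0 := hA.zero_mem hcl hne fun g hg x hx B hB =>
    forall_apply_mem_of_ae hsupp hB.1.isClosed (by
      filter_upwards [IsMaximizer.ae_preimage hΓ hinj hν₁ hν₂ hM hle hB] with h hh
      exact hx _ hh) ⟨g, hg⟩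
  have h0a : a ≤ 0 := (h0 _ (hAmax.inter_Ici hM ha hmin)).2
  exact ha0 (le_antisymm h0a a.2.1)

theorem MuInvariant.eq_of_nullSingletonClass (hΓ : ∀ g ∈ Γ, PiecewiseMonotone g) (hsupp : μ.support = univ)
    (hA : ConditionA Γ) (hinj : MuInjective μ) (hν₁ : MuInvariant μ ν₁)
    (hν₂ : MuInvariant μ ν₂) : ν₁ = ν₂ := by
  have hcont := (continuous_massDiff_Iic ν₁ ν₂).abs
  obtain ⟨x, -, hx⟩ := isCompact_univ.exists_isMaxOn univ_nonempty hcont.continuousOn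
  have hle : ∀ y, |massDiff ν₁ ν₂ (Iic y)| ≤ |massDiff ν₁ ν₂ (Iic x)| := fun y => hx (mem_univ y)
  set M := |massDiff ν₁ ν₂ (Iic x)| with hMdef
  rcases (abs_nonneg (massDiff ν₁ ν₂ (Iic x))).eq_or_lt with hM | hM
  · refine Measure.ext_of_Iic _ _ fun y => ?_
    have hy : massDiff ν₁ ν₂ (Iic y) = 0 := abs_nonpos_iff.1 (hM ▸ hle y)
    exact (measureReal_eq_measureReal_iff).1 (sub_eq_zero.1 hy)
  · exfalso
    obtain ⟨a, ha, hmin⟩ := (isClosed_eq hcont continuous_const :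
      IsClosed {y | |massDiff ν₁ ν₂ (Iic y)| = M}).isCompact.exists_isLeast ⟨x, rfl⟩
    have ha' : |massDiff ν₁ ν₂ (Iic a)| = M := ha
    rcases eq_or_eq_neg_of_abs_eq ha' with h | h
    · refine massDiff_Iic_ne_neg (a := a) hΓ hsupp hA hinj hν₂ hν₁ hM (fun y => ?_) (fun y hy => ?_) ?_
      · rw [massDiff_swap, abs_neg]
        exact hle y
      · rw [massDiff_swap, abs_neg] at hy
        exact hmin hy
      · rw [massDiff_swap, h]
    · exact massDiff_Iic_ne_neg hΓ hsupp hA hinj hν₁ hν₂ hM hle (fun y hy => hmin hy) h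

end UniqueErgodicity

end RandomMaps

theorem corollary4p7
    (Γ : Set C(unitInterval, unitInterval)) [MeasurableSpace Γ] [BorelSpace Γ]
    (hΓ : ∀ g ∈ Γ, RandomMaps.PiecewiseMonotone g)
    (μ : Measure Γ) [IsProbabilityMeasure μ]
    (hsupp : μ.support = Set.univ)
    (hA : RandomMaps.ConditionA Γ)
    (hinj : RandomMaps.MuInjective μ)
    (hdiag : RandomMaps.BelowDiagonalLeft μ ∨ RandomMaps.AboveDiagonalRight μ) :
    RandomMaps.UniquelyErgodic μ := by
  obtain ⟨ν, hν, hinv⟩ := RandomMaps.exists_invariant μ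
  refine ⟨ν, ⟨hν, hinv⟩, fun ν' hν' => ?_⟩
  have := hν'.1
  have := hinv.nullSingletonClass hsupp hA hinj
  have := hν'.2.nullSingletonClass hsupp hA hinj
  exact hν'.2.eq_of_nullSingletonClass hΓ hsupp hA hinj hinv
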